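/- **Programs.** Fix symbolic constants, numerals (identified with the integers) and program variables. *Program terms* are numerals, symbolic constants, variables and the symbols $\mathit{inf},\mathit{sup}$. Ground terms carry a total order with least element $\mathit{inf}$ and greatest element $\mathit{sup}$, which agrees with the order of the integers on numerals and puts numerals before symbolic constants. *Atoms* are $p(t_1,\dots,t_n)$, *comparisons* $t\prec t'$ with $\prec$ one of $=,\neq,<,>,\leq,\geq$. A *basic literal* is an atom or comparison, possibly preceded by $\mathit{not}$ or $\mathit{not\ not}$. An *aggregate element* $E$ is $t_1,\dots,t_k:l_1,\dots,l_m$ with program terms $t_i$ and basic literals $l_j$; an *aggregate atom* is $\mathit{op}\{E\}\prec u$ with $\mathit{op}\in\{\mathit{count},\mathit{sum}\}$ and a program term $u$ (the guard); an aggregate literal is an aggregate atom possibly preceded by $\mathit{not}$ or $\mathit{not\ not}$. A *rule* is $\mathit{Head}\leftarrow B_1,\dots,B_n$, where $\mathit{Head}$ is an atom or $\bot$ and each $B_i$ is a basic or aggregate literal. A *program* $\Pi$ is a (possibly infinite) set of rules. For a set $\Delta$ of tuples of ground terms, $\widehat{\mathit{count}}(\Delta)$ is $|\Delta|$ if $\Delta$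 is finite and $\mathit{sup}$ otherwise; $\widehat{\mathit{sum}}(\Delta)$ is the sum of the weights of the tuples in $\Delta$ if only finitely many are nonzero and $0$ otherwise, the weight of a tuple being its first member if that is a numeral, and $0$ otherwise. A variable is *global* in a rule if it occurs in its head, in a basic literal of its body, or in a guard. The *set symbol* of $E$ in a rule $R$ is $E/\mathbf X$, where $\mathbf X$ is the ordered list of the variables of $E$ that are global in $R$; $\mathbf Y$ denotes the list of the other variables of $E$. Let $\mathcal P$ and $\mathcal S$ be the sets of predicate symbols $p/n$ and of set symbols that occur in $\Pi$. **Target logic.** The signature has sorts *general*, *tuple*, *set*; ground terms as object constants; the symbols of $\mathcal P$, the comparison symbols other than $=$, and $\in$ as predicates; tuple constructors; $\mathit{count}$ and $\mathit{sum}$ from sets to general; and, for each $E/\mathbf X\in\mathcal S$, functions $s^{cli}_{E/\mathbf X}$ and $s^{dlv}_{E/\mathbf X}$ of $|\mathbf X|$ general arguments with values of sort set. The symbols in $\mathcal P$ and the functions $s^x_{E/\mathbf X}$ are intensional. Formulas use $\bot,\wedge,\vee,\to,\forall,\exists$, equality, and a second negation $\sim$ ($\neg F$ is $F\to\bot$).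 Classically $I\models{\sim}F$ iff $I\not\models F$. We write $H\preceq I$ if $H$ and $I$ have the same universes, agree on all non-intensional symbols, and $p^H\subseteq p^I$ for $p\in\mathcal P$; $H\prec I$ means $H\preceq I$ and $H\ne I$. For $H\preceq I$, $\langle H,I\rangle$ satisfies an atomic formula (equalities included) iff both $I$ and $H$ do; ${\sim}F$ iff $I\not\models F$ and $H\not\models F$; $F\to G$ iff $I\models F\to G$ and ($\langle H,I\rangle$ does not satisfy $F$ or satisfies $G$); $\bot,\wedge,\vee,\forall,\exists$ are as usual. **Translations.** For $x\in\{cli,dlv\}$, $\tau^x$ leaves atoms, comparisons and $\bot$ unchanged and maps $\mathit{op}\{E\}\prec u$ to $\mathit{op}(s^x_{E/\mathbf X}(\mathbf X))\prec u$; $\tau^{cli}$ maps $\mathit{not}\,A$, $\mathit{not\ not}\,A$ to $\neg\tau^{cli}A$, $\neg\neg\tau^{cli}A$, and $\tau^{dlv}$ maps them to ${\sim}\tau^{dlv}A$, ${\sim}{\sim}\tau^{dlv}A$. A rule is mapped to the universal closure, over its global variables, of $\tau^xB_1\wedge\dots\wedge\tau^xB_n\to\tau^x\mathit{Head}$, and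 $\tau^x\Pi$ is the set of translations of the rules of $\Pi$. **Agg-stable models.** An interpretation is *standard* if its general universe is the set of ground terms, its tuple universe consists of all tuples of ground terms whose length is the number $k$ of terms of $E$ for some $E/\mathbf X\in\mathcal S$, its set universe consists of all sets of such tuples, and ground terms, tuple constructors, comparisons (including $\neq$), $\in$, $\mathit{count}$ and $\mathit{sum}$ have their intended meaning (the last two being $\widehat{\mathit{count}}$ and $\widehat{\mathit{sum}}$). A standard $I$ is an *agg-interpretation* if, for all $E/\mathbf X\in\mathcal S$, $x\in\{cli,dlv\}$ and ground $\mathbf x$, $s^x_{E/\mathbf X}(\mathbf x)^I$ is the set of all tuples $\langle t_1,\dots,t_k\rangle^{\mathbf X\mathbf Y}_{\mathbf x\mathbf y}$ such that $I\models\bigl(\tau^x(l_1)\wedge\dots\wedge\tau^x(l_m)\bigr)^{\mathbf X\mathbf Y}_{\mathbf x\mathbf y}$. A pair $\langle H,I\rangle$ of standard interpretations with $H\preceq I$ is an *agg-ht-interpretation* if $I$ is an agg-interpretation and $s^{cli}_{E/\mathbf X}(\mathbf x)^H$, $s^{dlv}_{E/\mathbf X}(\mathbf x)^H$ are given by the same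 expression, with satisfaction by $\langle H,I\rangle$ of the $\tau^{cli}(l_j)$ for $cli$, and classical satisfaction by $H$ of the $\tau^{dlv}(l_j)$ for $dlv$. An agg-interpretation $I$ that is a model of $\Gamma$ is an *agg-stable model* of $\Gamma$ if there is no agg-ht-interpretation $\langle H,I\rangle$ with $H\prec I$ that satisfies $\Gamma$. A set $\mathcal A$ of ground atoms is a *fo-dlv answer set* of $\Pi$ if $\mathcal A$ is the set of ground atoms $p(\mathbf d)$, $p\in\mathcal P$, satisfied by some agg-stable model of $\tau^{dlv}\Pi$. **dlv answer sets.** The infinitary propositional formula $\tau\Pi$ is the conjunction, over all $R\in\Pi$ and all ground instantiations of the global variables of $R$, of $\tau B_1\wedge\dots\wedge\tau B_n\to\tau\mathit{Head}$. Here, on instantiated expressions, $\tau$ leaves atoms and $\bot$ unchanged, replaces a comparison by $\top$ or $\bot$ according to its truth value, maps $\mathit{not}\,A$, $\mathit{not\ not}\,A$ to $\neg\tau A$, $\neg\neg\tau A$, and maps $\mathit{op}\{E\}\prec u$, with $\mathbf X$ instantiated by $\mathbf x$, to $$\bigwedge_{\Delta\in\chi}\Bigl(\bigwedge_{\mathbf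 y\in\Delta}\mathbf l_{\mathbf y}\to\bigvee_{\mathbf y\notin\Delta}\mathbf l_{\mathbf y}\Bigr),\qquad \mathbf l_{\mathbf y}=\bigwedge_j\tau\bigl((l_j)^{\mathbf X\mathbf Y}_{\mathbf x\mathbf y}\bigr),$$ where $\mathbf y$ ranges over the tuples of ground terms of the length of $\mathbf Y$ and $\chi$ consists of the sets $\Delta$ of such tuples for which $\widehat{\mathit{op}}\{\langle t_1,\dots,t_k\rangle^{\mathbf X\mathbf Y}_{\mathbf x\mathbf y}:\mathbf y\in\Delta\}\prec u$ fails ($u$ being instantiated). The FLP-reduct of $F_1\to F_2$ with respect to a set $\mathcal A$ of ground atoms is $F_1\to F_2$ if $\mathcal A\models F_1$ and $\top$ otherwise; the reduct of a conjunction of implications is formed member by member. A set $\mathcal A$ of ground atoms is a *dlv answer set* of $\Pi$ if it is an FLP-stable model of $\tau\Pi$, that is, a $\subseteq$-minimal model of the FLP-reduct of $\tau\Pi$ with respect to $\mathcal A$. **Theorem.** For every program $\Pi$, the fo-dlv answer sets of $\Pi$ are exactly the dlv answer sets of $\Pi$. -/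

import Mathlib

namespace AggLP

/-! ## Syntax of programs with aggregates -/

/-- Ground program terms over the set `C` of symbolic constants (numerals are identified with
the corresponding integers). -/
inductive GTerm (C : Type) : Type
  | inf : GTerm C
  | num (n : ℤ) : GTerm C
  | sym (c : C) : GTerm C
  | sup : GTerm C

/-- The conditions on the total order chosen on ground terms. -/
structure AdmissibleOrder (C : Type) [LinearOrder (GTerm C)] : Prop where
  inf_le : ∀ g : GTerm C, GTerm.inf ≤ g
  le_sup : ∀ g : GTerm C, g ≤ GTerm.sup
  num_lt_num : ∀ m n : ℤ, (GTerm.num m : GTerm C) < GTerm.num n ↔ m < n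
  num_lt_sym : ∀ (n : ℤ) (c : C), (GTerm.num n : GTerm C) < GTerm.sym c

/-- Program terms over the symbolic constants `C` and the program variables `V`. -/
inductive PTerm (C V : Type) : Type
  | ground (g : GTerm C) : PTerm C V
  | var (v : V) : PTerm C V

/-- Comparison symbols. -/
inductive Cmp : Type
  | eq | ne | lt | gt | le | ge

/-- The relation on ground terms denoted by a comparison symbol. -/
def Cmp.Holds {C : Type} [LinearOrder (GTerm C)] : Cmp → GTerm C → GTerm C → Prop
  | .eq, a, b => a = b
  | .ne, a, b => a ≠ b
  | .lt, a, b => a < b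
  | .gt, a, b => b < a
  | .le, a, b => a ≤ b
  | .ge, a, b => b ≤ a

/-- Atoms `p(t₁,…,tₙ)`. -/
structure Atom (C V : Type) : Type where
  pred : C
  args : List (PTerm C V)

/-- Atomic formulas: atoms and comparisons. -/
inductive AtomicF (C V : Type) : Type
  | atom (A : Atom C V) : AtomicF C V
  | cmp (t : PTerm C V) (c : Cmp) (t' : PTerm C V) : AtomicF C V

/-- The prefix of a literal: nothing, `not`, or `not not`. -/
inductive Sign : Type
  | pos | neg | negneg

/-- Basic literals. -/
structure BasicLit (C V : Type) : Type where
  sign : Sign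
  form : AtomicF C V

/-- Aggregate elements `t₁,…,tₖ : l₁,…,lₘ`. -/
structure AggElem (C V : Type) : Type where
  terms : List (PTerm C V)
  lits : List (BasicLit C V)

/-- Operation names. -/
inductive Op : Type
  | count | sum

/-- Aggregate atoms `#op{E} ≺ u`. -/
structure AggAtom (C V : Type) : Type where
  op : Op
  elem : AggElem C V
  cmp : Cmp
  guard : PTerm C V

/-- Literals: basic literals and aggregate literals. -/
inductive Lit (C V : Type) : Type
  | basic (l : BasicLit C V) : Lit C V
  | agg (s : Sign) (A : AggAtom C V) : Lit C V

/-- Rules; the head `none` stands for `⊥`. -/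
structure Rule (C V : Type) : Type where
  head : Option (Atom C V)
  body : List (Lit C V)

/-- Programs are arbitrary (possibly infinite) sets of rules. -/
abbrev Program (C V : Type) : Type := Set (Rule C V)

/-! ## The functions associated with operation names -/

/-- The weight of a tuple of ground terms. -/
def weight {C : Type} : List (GTerm C) → ℤ
  | GTerm.num n :: _ => n
  | _ => 0

open Classical in
/-- The function on sets of tuples of ground terms associated with an operation name. -/
noncomputable def Op.hat {C : Type} : Op → Set (List (GTerm C)) → GTerm C
  | .count, D => if D.Finite then GTerm.num (D.ncard : ℤ) else GTerm.sup
  | .sum, D =>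
      if h : {t ∈ D | weight t ≠ 0}.Finite then GTerm.num (∑ t ∈ h.toFinset, weight t)
      else GTerm.num 0

/-! ## Variables and occurrences -/

section Variables

variable {C V : Type} [DecidableEq V]

def PTerm.vars : PTerm C V → Finset V
  | .ground _ => ∅
  | .var v => {v}

def listVars (ts : List (PTerm C V)) : Finset V :=
  ts.foldr (fun t W => t.vars ∪ W) ∅

def AtomicF.vars : AtomicF C V → Finset V
  | .atom A => listVars A.args
  | .cmp t _ t' => t.vars ∪ t'.vars

/-- The variables occurring in an aggregate element. -/
def AggElem.vars (E : AggElem C V) : Finset V :=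
  listVars E.terms ∪ E.lits.foldr (fun l W => l.form.vars ∪ W) ∅

/-- The contribution of a body literal to the global variables of the rule. -/
def Lit.globals : Lit C V → Finset V
  | .basic l => l.form.vars
  | .agg _ A => A.guard.vars

/-- The global variables of a rule: those occurring in a non-aggregate literal (the head
included) or in the guard of an aggregate literal. -/
def Rule.globals (R : Rule C V) : Finset V :=
  (match R.head with
    | none => ∅
    | some A => listVars A.args) ∪ R.body.foldr (fun L W => L.globals ∪ W) ∅

end Variables

/-- Set symbols `E/X`.  The list `X` is sorted and without repetitions, so that it is given by its
set of members. -/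
structure SetSym (C V : Type) : Type where
  elem : AggElem C V
  vars : Finset V

section Occurrences

variable {C V : Type} [DecidableEq V]

/-- The set symbol `E/X` where `X` consists of the variables of `E` that are global in `R`. -/
def Rule.setSym (R : Rule C V) (E : AggElem C V) : SetSym C V :=
  ⟨E, E.vars ∩ R.globals⟩

/-- The variables of `E` that are not in `X`. -/
def SetSym.locals (S : SetSym C V) : Finset V := S.elem.vars \ S.vars

/-- The set symbols occurring in a program. -/
def setSyms (P : Program C V) : Set (SetSym C V) :=
  {S | ∃ R ∈ P, ∃ s A, Lit.agg s A ∈ R.body ∧ S = R.setSym A.elem}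

/-- The basic literal `l` occurs in `P`, as a body literal or inside an aggregate element. -/
def HasLit (P : Program C V) (l : BasicLit C V) : Prop :=
  ∃ R ∈ P, Lit.basic l ∈ R.body ∨ ∃ s A, Lit.agg s A ∈ R.body ∧ l ∈ A.elem.lits

/-- The atom `A` occurs in `P`. -/
def HasAtom (P : Program C V) (A : Atom C V) : Prop :=
  (∃ R ∈ P, R.head = some A) ∨ ∃ l, HasLit P l ∧ l.form = AtomicF.atom A

/-- The predicate symbol `p/n` occurs in `P`. -/
def HasPred (P : Program C V) (p : C) (n : ℕ) : Prop :=
  ∃ A, HasAtom P A ∧ A.pred = p ∧ A.args.length = n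

/-- The numbers `k` such that some set symbol `E/X` of `P` has `E` with `k` terms. -/
def tupleLengths (P : Program C V) : Set ℕ :=
  {k | ∃ S ∈ setSyms P, S.elem.terms.length = k}

end Occurrences

/-! ## Valuations -/

section Valuations

variable {C V : Type} [DecidableEq V]

/-- The ground term obtained from a program term by the substitution `θ`. -/
def PTerm.inst (θ : V → GTerm C) : PTerm C V → GTerm C
  | .ground g => g
  | .var v => θ v

/-- The valuation that maps the variables in `W` as `w` says, and the others as `θ` does. -/
def override (W : Finset V) (w : {v // v ∈ W} → GTerm C) (θ : V → GTerm C) : V → GTerm C :=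
  fun v => if h : v ∈ W then w ⟨v, h⟩ else θ v

/-- The substitution of `w` for the variables `W`, as a total function; its values outside of
`W` are irrelevant wherever it is used. -/
def valOf (W : Finset V) (w : {v // v ∈ W} → GTerm C) : V → GTerm C :=
  override W w (fun _ => GTerm.inf)

end Valuations

/-! ## Many-sorted extended first-order logic and here-and-there semantics -/

/-- Many-sorted signatures (the subsort relation is equality).  The argument places of a symbol
are labelled by the members of a finite type. -/
structure Sig : Type 1 where
  Srt : Type
  Func : Type
  fArg : Func → Type
  fArg_finite : ∀ f, Finite (fArg f)
  fDom : (f : Func) → fArg f → Srt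
  fCod : Func → Srt
  Pred : Type
  pArg : Pred → Type
  pArg_finite : ∀ p, Finite (pArg p)
  pDom : (p : Pred) → pArg p → Srt

/-- Terms over `σ`, with the object variables `Var s` of each sort `s`. -/
inductive Term (σ : Sig) (Var : σ.Srt → Type) : σ.Srt → Type
  | var {s : σ.Srt} (x : Var s) : Term σ Var s
  | app (f : σ.Func) (ts : (i : σ.fArg f) → Term σ Var (σ.fDom f i)) : Term σ Var (σ.fCod f)

/-- Extended first-order formulas; `sneg` is the second negation connective. -/
inductive Form (σ : Sig) (Var : σ.Srt → Type) : Type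
  | pred (p : σ.Pred) (ts : (i : σ.pArg p) → Term σ Var (σ.pDom p i)) : Form σ Var
  | eq {s : σ.Srt} (t t' : Term σ Var s) : Form σ Var
  | bot : Form σ Var
  | sneg (F : Form σ Var) : Form σ Var
  | and (F G : Form σ Var) : Form σ Var
  | or (F G : Form σ Var) : Form σ Var
  | imp (F G : Form σ Var) : Form σ Var
  | all {s : σ.Srt} (x : Var s) (F : Form σ Var) : Form σ Var
  | ex {s : σ.Srt} (x : Var s) (F : Form σ Var) : Form σ Var

/-- The abbreviation `¬F`. -/
def Form.neg {σ : Sig} {Var : σ.Srt → Type} (F : Form σ Var) : Form σ Var := F.imp .bot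

/-- The empty conjunction. -/
def Form.top {σ : Sig} {Var : σ.Srt → Type} : Form σ Var := Form.neg .bot

/-- Conjunction of a list of formulas. -/
def Form.conjList {σ : Sig} {Var : σ.Srt → Type} (Fs : List (Form σ Var)) : Form σ Var :=
  Fs.foldr Form.and Form.top

/-- Interpretations of `σ` with universes `U`. -/
@[ext] structure Interp (σ : Sig) (U : σ.Srt → Type) : Type where
  func : (f : σ.Func) → ((i : σ.fArg f) → U (σ.fDom f i)) → U (σ.fCod f)
  pred : (p : σ.Pred) → ((i : σ.pArg p) → U (σ.pDom p i)) → Prop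

section Semantics

variable {σ : Sig} {Var : σ.Srt → Type} {U : σ.Srt → Type}

/-- The value of a term under an assignment of values to variables (assignments play the role of
the names of elements of the universes). -/
def Term.val (I : Interp σ U) (ρ : (s : σ.Srt) → Var s → U s) : {s : σ.Srt} → Term σ Var s → U s
  | _, .var x => ρ _ x
  | _, .app f ts => I.func f (fun i => (ts i).val I ρ)

open Classical in
/-- The assignment `ρ` with the value of `x` changed to `d`. -/
noncomputable def assign (ρ : (s : σ.Srt) → Var s → U s) {s : σ.Srt} (x : Var s) (d : U s) :
    (s : σ.Srt) → Var s → U s :=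
  Function.update ρ s (Function.update (ρ s) x d)

/-- Classical satisfaction. -/
def Form.Sat (I : Interp σ U) : ((s : σ.Srt) → Var s → U s) → Form σ Var → Prop
  | ρ, .pred p ts => I.pred p (fun i => (ts i).val I ρ)
  | ρ, .eq t t' => t.val I ρ = t'.val I ρ
  | _, .bot => False
  | ρ, .sneg F => ¬ Form.Sat I ρ F
  | ρ, .and F G => Form.Sat I ρ F ∧ Form.Sat I ρ G
  | ρ, .or F G => Form.Sat I ρ F ∨ Form.Sat I ρ G
  | ρ, .imp F G => Form.Sat I ρ F → Form.Sat I ρ G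
  | ρ, .all x F => ∀ d, Form.Sat I (assign ρ x d) F
  | ρ, .ex x F => ∃ d, Form.Sat I (assign ρ x d) F

/-- Satisfaction `⟨H,I⟩ ⊨ht F`. -/
def Form.HT (H I : Interp σ U) : ((s : σ.Srt) → Var s → U s) → Form σ Var → Prop
  | ρ, .pred p ts => Form.Sat I ρ (.pred p ts) ∧ Form.Sat H ρ (.pred p ts)
  | ρ, .eq t t' => t.val I ρ = t'.val I ρ ∧ t.val H ρ = t'.val H ρ
  | _, .bot => False
  | ρ, .sneg F => ¬ Form.Sat I ρ F ∧ ¬ Form.Sat H ρ F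
  | ρ, .and F G => Form.HT H I ρ F ∧ Form.HT H I ρ G
  | ρ, .or F G => Form.HT H I ρ F ∨ Form.HT H I ρ G
  | ρ, .imp F G => Form.Sat I ρ (.imp F G) ∧ (¬ Form.HT H I ρ F ∨ Form.HT H I ρ G)
  | ρ, .all x F => ∀ d, Form.HT H I (assign ρ x d) F
  | ρ, .ex x F => ∃ d, Form.HT H I (assign ρ x d) F

/-- `I` is a model of a set of sentences. -/
def Models (I : Interp σ U) (Γ : Set (Form σ Var)) : Prop :=
  ∀ F ∈ Γ, ∀ ρ, Form.Sat I ρ F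

/-- `⟨H,I⟩` satisfies a set of sentences. -/
def HTModels (H I : Interp σ U) (Γ : Set (Form σ Var)) : Prop :=
  ∀ F ∈ Γ, ∀ ρ, Form.HT H I ρ F

/-- `H ⪯ I` with respect to the intensional predicate symbols `IP` and function symbols `IF`
(equality of the universes is built into the typing). -/
structure Interp.Below (IP : Set σ.Pred) (IF : Set σ.Func) (H I : Interp σ U) : Prop where
  pred_sub : ∀ p ∈ IP, ∀ d, H.pred p d → I.pred p d
  pred_eq : ∀ p, p ∉ IP → H.pred p = I.pred p
  func_eq : ∀ f, f ∉ IF → H.func f = I.func f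

/-- `H ≺ I`. -/
def Interp.StrictlyBelow (IP : Set σ.Pred) (IF : Set σ.Func) (H I : Interp σ U) : Prop :=
  Interp.Below IP IF H I ∧ H ≠ I

end Semantics

/-! ## The target signature of a program -/

inductive TSort : Type
  | gen | tuple | set

/-- The two semantics. -/
inductive Sem : Type
  | cli | dlv

section Target

variable {C V : Type} [DecidableEq V]

/-- Function constants: ground terms, tuple constructors, `count` and `sum`, and the set function
symbols `s^cli` and `s^dlv` of each set symbol of the program. -/
inductive FuncSym (P : Program C V) : Type
  | obj (g : GTerm C) : FuncSym P
  | tuple (k : ℕ) (h : k ∈ tupleLengths P) : FuncSym P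
  | op (o : Op) : FuncSym P
  | setfn (x : Sem) (S : SetSym C V) (h : S ∈ setSyms P) : FuncSym P

/-- Predicate constants: the predicate symbols of the program, the comparison symbols other than
equality, and membership. -/
inductive PredSym (P : Program C V) : Type
  | pred (p : C) (n : ℕ) (h : HasPred P p n) : PredSym P
  | cmp (c : Cmp) (h : c ≠ Cmp.eq) : PredSym P
  | mem : PredSym P

def FuncSym.Arg {P : Program C V} : FuncSym P → Type
  | .obj _ => Fin 0
  | .tuple k _ => Fin k
  | .op _ => Fin 1
  | .setfn _ S _ => {v // v ∈ S.vars}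

def FuncSym.dom {P : Program C V} : (f : FuncSym P) → f.Arg → TSort
  | .obj _ => fun _ => .gen
  | .tuple _ _ => fun _ => .gen
  | .op _ => fun _ => .set
  | .setfn _ _ _ => fun _ => .gen

def FuncSym.cod {P : Program C V} : FuncSym P → TSort
  | .obj _ => .gen
  | .tuple _ _ => .tuple
  | .op _ => .gen
  | .setfn _ _ _ => .set

def PredSym.Arg {P : Program C V} : PredSym P → Type
  | .pred _ n _ => Fin n
  | .cmp _ _ => Fin 2
  | .mem => Fin 2

def PredSym.dom {P : Program C V} : (p : PredSym P) → p.Arg → TSort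
  | .pred _ _ _ => fun _ => .gen
  | .cmp _ _ => fun _ => .gen
  | .mem => ![.tuple, .set]

/-- The signature `σ(𝒫,𝒮)` of a program. -/
@[reducible] def sig (P : Program C V) : Sig where
  Srt := TSort
  Func := FuncSym P
  fArg := FuncSym.Arg
  fArg_finite := by
    intro f
    cases f <;> simp only [FuncSym.Arg] <;> infer_instance
  fDom := FuncSym.dom
  fCod := FuncSym.cod
  Pred := PredSym P
  pArg := PredSym.Arg
  pArg_finite := by
    intro p
    cases p <;> simp only [PredSym.Arg] <;> infer_instance
  pDom := PredSym.dom

/-- Object variables: the program variables are the variables of the general sort.  Variables of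
the other two sorts do not occur in the formulas considered here, and are left out (thus an
assignment exists even when there are no tuples). -/
def TVar (V : Type) : TSort → Type
  | .gen => V
  | .tuple => Empty
  | .set => Empty

/-- Terms and formulas over the signature of a program. -/
abbrev TTerm (P : Program C V) (s : TSort) : Type := Term (sig P) (TVar V) s
abbrev TForm (P : Program C V) : Type := Form (sig P) (TVar V)

/-- The intensional predicate symbols. -/
def intPred (P : Program C V) : Set (sig P).Pred := {q | ∃ p n h, q = PredSym.pred p n h}

/-- The intensional function symbols. -/
def intFunc (P : Program C V) : Set (sig P).Func := {f | ∃ x S h, f = FuncSym.setfn x S h}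

/-! ## The translations `τ^cli` and `τ^dlv` -/

def tauTerm (P : Program C V) : PTerm C V → TTerm P .gen
  | .ground g => Term.app (σ := sig P) (FuncSym.obj g) (fun i => i.elim0)
  | .var v => Term.var (σ := sig P) (Var := TVar V) (s := TSort.gen) v

/-- The atomic formula `t ≺ t'`. -/
def cmpForm (P : Program C V) (c : Cmp) (t t' : TTerm P .gen) : TForm P :=
  match c with
  | .eq => Form.eq t t'
  | .ne => Form.pred (σ := sig P) (PredSym.cmp .ne (by simp)) ![t, t']
  | .lt => Form.pred (σ := sig P) (PredSym.cmp .lt (by simp)) ![t, t']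
  | .gt => Form.pred (σ := sig P) (PredSym.cmp .gt (by simp)) ![t, t']
  | .le => Form.pred (σ := sig P) (PredSym.cmp .le (by simp)) ![t, t']
  | .ge => Form.pred (σ := sig P) (PredSym.cmp .ge (by simp)) ![t, t']

def tauAtom (P : Program C V) (A : Atom C V) (h : HasAtom P A) : TForm P :=
  Form.pred (σ := sig P) (PredSym.pred A.pred A.args.length ⟨A, h, rfl, rfl⟩)
    (fun i : Fin A.args.length => tauTerm P (A.args.get i))

/-- The translation of `not`, in each of the two semantics. -/
def signed (P : Program C V) : Sem → Sign → TForm P → TForm P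
  | _, .pos, F => F
  | .cli, .neg, F => F.neg
  | .cli, .negneg, F => F.neg.neg
  | .dlv, .neg, F => F.sneg
  | .dlv, .negneg, F => F.sneg.sneg

def tauAtomic (P : Program C V) (F : AtomicF C V)
    (h : ∀ A, F = AtomicF.atom A → HasAtom P A) : TForm P :=
  match F, h with
  | .atom A, h => tauAtom P A (h A rfl)
  | .cmp t c t', _ => cmpForm P c (tauTerm P t) (tauTerm P t')

def tauBasic (P : Program C V) (x : Sem) (l : BasicLit C V) (h : HasLit P l) : TForm P :=
  signed P x l.sign (tauAtomic P l.form (fun _ hA => Or.inr ⟨l, h, hA⟩))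

/-- The atom `op(s^x_{|E/X|}(X)) ≺ u`. -/
def tauAggAtom (P : Program C V) (x : Sem) (S : SetSym C V) (hS : S ∈ setSyms P)
    (op : Op) (c : Cmp) (u : PTerm C V) : TForm P :=
  cmpForm P c
    (Term.app (σ := sig P) (FuncSym.op op) (fun _ =>
      Term.app (σ := sig P) (FuncSym.setfn x S hS) (fun v : {v // v ∈ S.vars} =>
        Term.var (σ := sig P) (Var := TVar V) (s := TSort.gen) v.1)))
    (tauTerm P u)

/-- The translation of a literal in the body of the rule `R`. -/
def tauLit (P : Program C V) (x : Sem) (R : Rule C V) (hR : R ∈ P) (L : Lit C V)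
    (hL : L ∈ R.body) : TForm P :=
  match L, hL with
  | .basic l, hL => tauBasic P x l ⟨R, hR, Or.inl hL⟩
  | .agg s A, hL =>
      signed P x s
        (tauAggAtom P x (R.setSym A.elem) ⟨R, hR, s, A, hL, rfl⟩ A.op A.cmp A.guard)

def tauHead (P : Program C V) (R : Rule C V) (hR : R ∈ P) : TForm P :=
  match h : R.head with
  | none => Form.bot
  | some A => tauAtom P A (Or.inl ⟨R, hR, h⟩)

/-- The formula `∀ Z F`. -/
noncomputable def closure (P : Program C V) (Z : Finset V) (F : TForm P) : TForm P :=
  Z.toList.foldr (fun v G => Form.all (σ := sig P) (Var := TVar V) (s := TSort.gen) v G) F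

/-- The translation of a rule. -/
noncomputable def tauRule (P : Program C V) (x : Sem) (R : Rule C V) (hR : R ∈ P) : TForm P :=
  closure P R.globals
    (Form.imp (Form.conjList (R.body.attach.map (fun L => tauLit P x R hR L.1 L.2)))
      (tauHead P R hR))

/-- The translation of a program. -/
def tauProgram (P : Program C V) (x : Sem) : Set (TForm P) :=
  {F | ∃ R, ∃ hR : R ∈ P, F = tauRule P x R hR}

/-! ## Standard interpretations and agg-interpretations -/

/-- The tuples of ground terms whose lengths come from the set symbols of the program. -/
abbrev Tuple (P : Program C V) : Type := {t : List (GTerm C) // t.length ∈ tupleLengths P}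

/-- The universes of standard interpretations; the elements of the set sort are all sets of
tuples. -/
def StdU (P : Program C V) : TSort → Type
  | .gen => GTerm C
  | .tuple => Tuple P
  | .set => Set (Tuple P)

/-- Interpretations with the standard universes. -/
abbrev TInterp (P : Program C V) : Type := Interp (sig P) (StdU P)

/-- Standard interpretations. -/
structure IsStandard [LinearOrder (GTerm C)] (P : Program C V) (I : TInterp P) : Prop where
  obj : ∀ (g : GTerm C) d, I.func (FuncSym.obj g) d = g
  cmp : ∀ (c : Cmp) (h : c ≠ Cmp.eq) (d : Fin 2 → GTerm C),
    I.pred (PredSym.cmp c h) d ↔ c.Holds (d 0) (d 1)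
  tuple : ∀ (k : ℕ) (h : k ∈ tupleLengths P) (d : Fin k → GTerm C),
    I.func (FuncSym.tuple k h) d = (⟨List.ofFn d, by simpa using h⟩ : Tuple P)
  mem : ∀ d, I.pred PredSym.mem d ↔
    Membership.mem (α := Tuple P) (γ := Set (Tuple P)) (d (1 : Fin 2)) (d (0 : Fin 2))
  op : ∀ (o : Op) (s : Set (Tuple P)),
    I.func (FuncSym.op o) (fun _ : Fin 1 => s) = o.hat (Subtype.val '' s)

/-- The assignment of values to object variables given by a valuation of program variables. -/
def envOf (P : Program C V) (θ : V → GTerm C) : (s : TSort) → TVar V s → StdU P s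
  | .gen => θ
  | .tuple => fun e => e.elim
  | .set => fun e => e.elim

/-- A literal of the aggregate element of a set symbol of `P` occurs in `P`. -/
theorem hasLit_of_setSym {P : Program C V} {S : SetSym C V} (hS : S ∈ setSyms P)
    {l : BasicLit C V} (hl : l ∈ S.elem.lits) : HasLit P l := by
  obtain ⟨R, hR, s, A, hA, rfl⟩ := hS
  exact ⟨R, hR, Or.inr ⟨s, A, hA, hl⟩⟩

/-- For the set symbol `E/X` and values `a` of `X`: the set of all tuples
`(t₁,…,tₖ)` instantiated by `a` for `X` and some `y` for the other variables `Y` of `E`, such that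
the formulas `τ^x(l₁),…,τ^x(lₘ)` so instantiated hold in the sense of `sat`. -/
def aggSet (P : Program C V) (x : Sem) (S : SetSym C V) (hS : S ∈ setSyms P)
    (sat : ((s : TSort) → TVar V s → StdU P s) → TForm P → Prop)
    (a : {v // v ∈ S.vars} → GTerm C) : Set (Tuple P) :=
  {t | ∃ y : {v // v ∈ S.locals} → GTerm C,
    t.1 = S.elem.terms.map (PTerm.inst (override S.locals y (valOf S.vars a))) ∧
    ∀ l, ∀ hl : l ∈ S.elem.lits,
      sat (envOf P (override S.locals y (valOf S.vars a)))
        (tauBasic P x l (hasLit_of_setSym hS hl))}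

/-- Agg-interpretations. -/
structure IsAgg [LinearOrder (GTerm C)] (P : Program C V) (I : TInterp P) : Prop where
  std : IsStandard P I
  set : ∀ (x : Sem) (S : SetSym C V) (hS : S ∈ setSyms P) (a : {v // v ∈ S.vars} → GTerm C),
    I.func (FuncSym.setfn x S hS) a = aggSet P x S hS (Form.Sat I) a

/-- Agg-ht-interpretations. -/
structure IsAggHT [LinearOrder (GTerm C)] (P : Program C V) (H I : TInterp P) : Prop where
  below : Interp.Below (intPred P) (intFunc P) H I
  stdH : IsStandard P H
  agg : IsAgg P I
  cli : ∀ (S : SetSym C V) (hS : S ∈ setSyms P) (a : {v // v ∈ S.vars} → GTerm C),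
    H.func (FuncSym.setfn .cli S hS) a = aggSet P .cli S hS (Form.HT H I) a
  dlv : ∀ (S : SetSym C V) (hS : S ∈ setSyms P) (a : {v // v ∈ S.vars} → GTerm C),
    H.func (FuncSym.setfn .dlv S hS) a = aggSet P .dlv S hS (Form.Sat H) a

/-- Agg-stable models of a set of sentences. -/
structure IsAggStable [LinearOrder (GTerm C)] (P : Program C V) (Γ : Set (TForm P))
    (I : TInterp P) : Prop where
  agg : IsAgg P I
  model : Models I Γ
  stable : ¬ ∃ H : TInterp P, IsAggHT P H I ∧ HTModels H I Γ ∧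
    Interp.StrictlyBelow (intPred P) (intFunc P) H I

end Target

/-- Ground atoms `p(d₁,…,dₙ)`. -/
structure GAtom (C : Type) : Type where
  pred : C
  args : List (GTerm C)

section AnswerSets

variable {C V : Type} [DecidableEq V]

/-- The set of ground atoms (with a predicate symbol of the program) satisfied by `I`. -/
def ans (P : Program C V) (I : TInterp P) : Set (GAtom C) :=
  {A | ∃ h : HasPred P A.pred A.args.length,
    I.pred (PredSym.pred A.pred A.args.length h) (fun i : Fin A.args.length => A.args.get i)}

/-- fo-dlv answer sets. -/
def IsFoDlvAnswerSet [LinearOrder (GTerm C)] (P : Program C V) (A : Set (GAtom C)) : Prop :=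
  ∃ I : TInterp P, IsAggStable P (tauProgram P .dlv) I ∧ A = ans P I

end AnswerSets

/-! ## Infinitary formulas and the FLP semantics -/

/-- Standard infinitary propositional formulas over the atoms `α`; sets of formulas are given as
indexed families. -/
inductive InfForm (α : Type) : Type 1
  | atom (a : α) : InfForm α
  | conj {ι : Type} (F : ι → InfForm α) : InfForm α
  | disj {ι : Type} (F : ι → InfForm α) : InfForm α
  | imp (F G : InfForm α) : InfForm α

namespace InfForm

variable {α : Type}

def top : InfForm α := conj (fun e : Empty => e.elim)
def bot : InfForm α := disj (fun e : Empty => e.elim)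
def neg (F : InfForm α) : InfForm α := imp F bot

/-- Finite conjunction of a list of formulas. -/
def conjList (Fs : List (InfForm α)) : InfForm α := conj (fun i : Fin Fs.length => Fs.get i)

/-- Satisfaction by a propositional interpretation. -/
def Sat (A : Set α) : InfForm α → Prop
  | .atom a => a ∈ A
  | .conj F => ∀ i, Sat A (F i)
  | .disj F => ∃ i, Sat A (F i)
  | .imp F G => Sat A F → Sat A G

open Classical in
/-- The FLP-reduct of implications and of (nested) conjunctions of implications; it is applied
only to such formulas. -/
noncomputable def flp (A : Set α) : InfForm α → InfForm α
  | .imp F G => if Sat A F then .imp F G else top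
  | .conj F => .conj (fun i => flp A (F i))
  | .atom a => .atom a
  | .disj F => .disj F

/-- `A` is a `⊆`-minimal model of `F`. -/
def IsMinimalModel (A : Set α) (F : InfForm α) : Prop :=
  Sat A F ∧ ¬ ∃ B : Set α, B ⊂ A ∧ Sat B F

/-- `A` is an FLP-stable model of `F`. -/
def IsFLPStable (A : Set α) (F : InfForm α) : Prop :=
  IsMinimalModel A (flp A F)

end InfForm

/-! ## The translation `τ` into infinitary formulas -/

section Tau

variable {C V : Type} [DecidableEq V]

def Atom.inst (θ : V → GTerm C) (A : Atom C V) : GAtom C :=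
  ⟨A.pred, A.args.map (PTerm.inst θ)⟩

def infSigned : Sign → InfForm (GAtom C) → InfForm (GAtom C)
  | .pos, F => F
  | .neg, F => F.neg
  | .negneg, F => F.neg.neg

variable [LinearOrder (GTerm C)]

open Classical in
/-- `τ` of the instance of an atomic formula by `θ`. -/
noncomputable def infAtomic (θ : V → GTerm C) : AtomicF C V → InfForm (GAtom C)
  | .atom A => .atom (A.inst θ)
  | .cmp t c t' => if c.Holds (t.inst θ) (t'.inst θ) then InfForm.top else InfForm.bot

noncomputable def infBasic (θ : V → GTerm C) (l : BasicLit C V) : InfForm (GAtom C) :=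
  infSigned l.sign (infAtomic θ l.form)

/-- The conjunction of the literals of an aggregate element, instantiated by `θ`. -/
noncomputable def infLits (θ : V → GTerm C) (E : AggElem C V) : InfForm (GAtom C) :=
  InfForm.conjList (E.lits.map (infBasic θ))

/-- The set `D` of tuples of values of the local variables `Y` justifies `op{E} ≺ u`, where the
global variables are instantiated by `θ`. -/
def Justifies (θ : V → GTerm C) (Y : Finset V) (A : AggAtom C V)
    (D : Set ({v // v ∈ Y} → GTerm C)) : Prop :=
  A.cmp.Holds
    (A.op.hat ((fun y => A.elem.terms.map (PTerm.inst (override Y y θ))) '' D))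
    (A.guard.inst θ)

/-- `τ` of an aggregate atom with the local variables `Y`, where the global variables are
instantiated by `θ`. -/
noncomputable def infAgg (θ : V → GTerm C) (Y : Finset V) (A : AggAtom C V) :
    InfForm (GAtom C) :=
  InfForm.conj (fun D : {D : Set ({v // v ∈ Y} → GTerm C) // ¬ Justifies θ Y A D} =>
    InfForm.imp
      (InfForm.conj (fun y : {y // y ∈ D.1} => infLits (override Y y.1 θ) A.elem))
      (InfForm.disj (fun y : {y // y ∉ D.1} => infLits (override Y y.1 θ) A.elem)))

noncomputable def infLit (R : Rule C V) (θ : V → GTerm C) : Lit C V → InfForm (GAtom C)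
  | .basic l => infBasic θ l
  | .agg s A => infSigned s (infAgg θ (R.setSym A.elem).locals A)

def infHead (θ : V → GTerm C) : Option (Atom C V) → InfForm (GAtom C)
  | none => InfForm.bot
  | some A => .atom (A.inst θ)

/-- `τ R`: the conjunction of all instances of `R` with respect to its global variables. -/
noncomputable def infRule (R : Rule C V) : InfForm (GAtom C) :=
  InfForm.conj (fun z : {v // v ∈ R.globals} → GTerm C =>
    InfForm.imp
      (InfForm.conjList (R.body.map (infLit R (valOf R.globals z))))
      (infHead (valOf R.globals z) R.head))

/-- `τ` of a program. -/
noncomputable def infProgram (P : Program C V) : InfForm (GAtom C) :=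
  InfForm.conj (fun R : {R // R ∈ P} => infRule R.1)

/-- dlv answer sets. -/
def IsDlvAnswerSet (P : Program C V) (A : Set (GAtom C)) : Prop :=
  InfForm.IsFLPStable A (infProgram P)

end Tau

end AggLP

/-! Why the two semantics agree. Bodies in `τ^dlv Π` are conjunctions of atomic formulas and
formulas that start with `∼`. Each of these holds in `⟨H,I⟩` exactly when it holds classically in
both `I` and `H` (`tauLit_dlv_splits`). So once `I` is a model, `⟨H,I⟩` satisfies a rule instance
iff the truth of the body in both `I` and `H` forces the head in `H`. That is what the FLP-reduct
says, `I` selecting the surviving implications and `H` being the candidate smaller model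
(`htModels_tauProgram_iff`).

Classical truth carries over to infinitary truth because `s^dlv` collects, in either world, the
tuples whose conditions hold classically there. The infinitary aggregate excludes every
non-justifying `Δ` as the set of instances whose conditions hold, so it says that this set is
justifying (`sat_infAgg`, `sat_tauAggAtom`).

It remains to match candidates. The literals inside an aggregate element contain no aggregates, so
the ground atoms of `H` determine its set functions, given `I`. Hence the worlds `H` below `I`
correspond to the subsets of `ans P I` (`exists_isAggHT`, `IsAggHT.eq_of_ans_eq`), and `H ≺ I` to
proper inclusion. Atoms with predicate symbols foreign to the program are invisible to
interpretations; minimality keeps them out of dlv answer sets (`IsDlvAnswerSet.eq_ans`). -/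

namespace AggLP

/-! ## Elementary facts about satisfaction -/

section General

variable {σ : Sig} {Var : σ.Srt → Type} {U : σ.Srt → Type}

theorem assign_self (ρ : (s : σ.Srt) → Var s → U s) {s : σ.Srt} (x : Var s) :
    assign ρ x (ρ s x) = ρ := by
  simp [assign]

/-- A formula splits if here-and-there satisfaction amounts to classical satisfaction in both
worlds. -/
def Form.Splits (U : σ.Srt → Type) (F : Form σ Var) : Prop :=
  ∀ (H I : Interp σ U) ρ, Form.HT H I ρ F ↔ Form.Sat I ρ F ∧ Form.Sat H ρ F

theorem Form.ht_self (I : Interp σ U) (F : Form σ Var) :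
    ∀ ρ, Form.HT I I ρ F ↔ Form.Sat I ρ F := by
  induction F <;> intro ρ <;> simp_all [Form.HT, Form.Sat]
  tauto

/-- No assumption on `F` is needed, since the ht clause for `∼` already refers to classical
satisfaction in the two worlds. -/
theorem Form.splits_sneg (F : Form σ Var) : (Form.sneg F).Splits U := fun _ _ _ => by
  simp [Form.HT, Form.Sat]

theorem Form.splits_conjList {Fs : List (Form σ Var)} (h : ∀ F ∈ Fs, F.Splits U) :
    (Form.conjList Fs).Splits U := by
  induction Fs with
  | nil =>
    intro H I ρ
    simp [Form.conjList, Form.top, Form.neg, Form.HT, Form.Sat]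
  | cons F Fs ih =>
    intro H I ρ
    have h1 := h F (by simp) H I ρ
    have h2 := ih (fun G hG => h G (by simp [hG])) H I ρ
    simp only [Form.conjList, List.foldr_cons, Form.HT, Form.Sat] at h2 ⊢
    rw [h1, h2]
    tauto

theorem Form.sat_conjList {I : Interp σ U} {ρ} {Fs : List (Form σ Var)} :
    Form.Sat I ρ (Form.conjList Fs) ↔ ∀ F ∈ Fs, Form.Sat I ρ F := by
  induction Fs with
  | nil => simp [Form.conjList, Form.top, Form.neg, Form.Sat]
  | cons F Fs ih =>
    simp only [Form.conjList, List.foldr_cons, Form.Sat] at ih ⊢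
    simp [ih]

end General

theorem InfForm.sat_conjList {α : Type} {A : Set α} {Fs : List (InfForm α)} :
    InfForm.Sat A (InfForm.conjList Fs) ↔ ∀ F ∈ Fs, InfForm.Sat A F := by
  simp only [InfForm.conjList, InfForm.Sat, List.forall_mem_iff_get]

theorem InfForm.sat_bot {α : Type} {A : Set α} : ¬ InfForm.Sat A (InfForm.bot : InfForm α) := by
  simp [InfForm.bot, InfForm.Sat]

theorem InfForm.sat_top {α : Type} {A : Set α} : InfForm.Sat A (InfForm.top : InfForm α) := by
  simp [InfForm.top, InfForm.Sat]

theorem InfForm.sat_flp_imp {α : Type} {A B : Set α} {F G : InfForm α} :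
    InfForm.Sat B (InfForm.flp A (.imp F G)) ↔
      (InfForm.Sat A F → InfForm.Sat B F → InfForm.Sat B G) := by
  by_cases h : InfForm.Sat A F
  · simp [InfForm.flp, h, InfForm.Sat]
  · simp [InfForm.flp, h, InfForm.sat_top]

/-! ## Substitutions that agree on the variables that matter -/

theorem PTerm.inst_congr {C V : Type} {θ θ' : V → GTerm C} {t : PTerm C V} (h : ∀ v ∈ t.vars, θ v = θ' v) :
    t.inst θ = t.inst θ' := by
  cases t with
  | ground g => rfl
  | var v => exact h v (by simp [PTerm.vars])

section Congruence

variable {C V : Type} [DecidableEq V]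

theorem mem_foldr_union {α : Type} (f : α → Finset V) (l : List α) (v : V) :
    v ∈ l.foldr (fun a W => f a ∪ W) ∅ ↔ ∃ a ∈ l, v ∈ f a := by
  induction l with
  | nil => simp
  | cons a l ih => simp [ih]

theorem mem_listVars {ts : List (PTerm C V)} {v : V} : v ∈ listVars ts ↔ ∃ t ∈ ts, v ∈ t.vars :=
  mem_foldr_union _ _ _

theorem map_inst_congr {θ θ' : V → GTerm C} {ts : List (PTerm C V)}
    (h : ∀ v ∈ listVars ts, θ v = θ' v) : ts.map (PTerm.inst θ) = ts.map (PTerm.inst θ') :=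
  List.map_congr_left fun t ht =>
    PTerm.inst_congr fun v hv => h v (mem_listVars.2 ⟨t, ht, hv⟩)

theorem infBasic_congr [LinearOrder (GTerm C)] {θ θ' : V → GTerm C} {l : BasicLit C V}
    (h : ∀ v ∈ l.form.vars, θ v = θ' v) : infBasic θ l = infBasic θ' l := by
  obtain ⟨s, F⟩ := l
  have : infAtomic θ F = infAtomic θ' F := by
    cases F with
    | atom A => simp only [infAtomic, Atom.inst, map_inst_congr h]
    | cmp t c t' =>
      have h1 : t.inst θ = t.inst θ' :=
        PTerm.inst_congr fun v hv => h v (by simp [AtomicF.vars, hv])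
      have h2 : t'.inst θ = t'.inst θ' :=
        PTerm.inst_congr fun v hv => h v (by simp [AtomicF.vars, hv])
      simp only [infAtomic]
      rw [h1, h2]
  simp only [infBasic, this]

theorem AggElem.mem_vars {E : AggElem C V} {v : V} :
    v ∈ E.vars ↔ v ∈ listVars E.terms ∨ ∃ l ∈ E.lits, v ∈ l.form.vars := by
  rw [AggElem.vars, Finset.mem_union, mem_foldr_union (fun l : BasicLit C V => l.form.vars)]

theorem Rule.mem_globals_of_body {R : Rule C V} {L : Lit C V} (hL : L ∈ R.body) {v : V}
    (hv : v ∈ L.globals) : v ∈ R.globals :=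
  Finset.mem_union_right _ ((mem_foldr_union Lit.globals _ _).2 ⟨L, hL, hv⟩)

theorem Rule.mem_globals_of_head {R : Rule C V} {A : Atom C V} (hA : R.head = some A) {v : V}
    (hv : v ∈ listVars A.args) : v ∈ R.globals := by
  simp [Rule.globals, hA, hv]

theorem infHead_congr {R : Rule C V} {θ θ' : V → GTerm C}
    (h : ∀ v ∈ R.globals, θ v = θ' v) : infHead θ R.head = infHead θ' R.head := by
  cases hA : R.head with
  | none => rfl
  | some A =>
    simp only [infHead, Atom.inst,
      map_inst_congr fun v hv => h v (Rule.mem_globals_of_head hA hv)]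

/-- Reconciles two ways of instantiating an aggregate element: `aggSet` keeps only the values of `X`
and uses a default elsewhere, while `infAgg` overrides a full valuation. Every variable of `E` is
either local or in `X`, so the default is never read. -/
theorem override_agree {E : AggElem C V} {G : Finset V} {θ θ' : V → GTerm C}
    (h : ∀ v ∈ G, θ v = θ' v) (y : {v // v ∈ E.vars \ (E.vars ∩ G)} → GTerm C) :
    ∀ v ∈ E.vars, override _ y (valOf (E.vars ∩ G) fun v => θ v.1) v = override _ y θ' v := by
  intro v hv
  by_cases hG : v ∈ G
  · simp [override, valOf, hv, hG, h v hG]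
  · simp [override, hv, hG]

theorem valOf_agree (W : Finset V) (θ : V → GTerm C) :
    ∀ v ∈ W, θ v = valOf W (fun v => θ v.1) v := by
  intro v hv
  simp [valOf, override, hv]

/-- An aggregate atom holds iff the tuples satisfying its conditions justify it. -/
theorem sat_infAgg [LinearOrder (GTerm C)] {B : Set (GAtom C)} {θ : V → GTerm C} {Y : Finset V}
    {A : AggAtom C V} :
    InfForm.Sat B (infAgg θ Y A) ↔
      Justifies θ Y A {y | InfForm.Sat B (infLits (override Y y θ) A.elem)} := by
  simp only [infAgg, InfForm.Sat]
  constructor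
  · intro h
    by_contra hn
    -- For `Δ` the set of all `y` whose conditions hold, the antecedent is trivially true and the
    -- consequent is false.
    obtain ⟨⟨y, hy⟩, hs⟩ := h ⟨_, hn⟩ fun y => y.2
    exact hy hs
  · rintro h ⟨D, hD⟩ hs
    by_contra hn
    push Not at hn
    -- A `Δ` whose implication fails consists of exactly the `y` whose conditions hold, and that set
    -- is justifying.
    apply hD
    convert h using 1
    ext y
    exact ⟨fun hy => hs ⟨y, hy⟩, fun hy => by_contra fun hyD => hn ⟨y, hyD⟩ hy⟩

end Congruence

/-! ## Standard interpretations and sets of ground atoms -/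

section Target

variable {C V : Type} [DecidableEq V]

/-- The interpretation `J` satisfies the same ground atoms over the signature as the set `B`. -/
def Represents (P : Program C V) (J : TInterp P) (B : Set (GAtom C)) : Prop :=
  ∀ p n (h : HasPred P p n) (d : Fin n → GTerm C),
    J.pred (PredSym.pred p n h) d ↔ (⟨p, List.ofFn d⟩ : GAtom C) ∈ B

theorem mem_ans_ofFn {P : Program C V} {J : TInterp P} {p : C} {n : ℕ} (h : HasPred P p n)
    (d : Fin n → GTerm C) :
    (⟨p, List.ofFn d⟩ : GAtom C) ∈ ans P J ↔ J.pred (PredSym.pred p n h) d := by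
  -- The arity is part of the predicate symbol; with a free list `l`, `subst` removes the mismatch
  -- between `l.length` and `n`.
  have key : ∀ (l : List (GTerm C)) (hn : l.length = n) (h' : HasPred P p l.length),
      J.pred (PredSym.pred p l.length h') (fun i : Fin l.length => l.get i) ↔
        J.pred (PredSym.pred p n h) (fun i : Fin n => l.get (i.cast hn.symm)) := by
    intro l hn h'
    subst hn
    rfl
  have hlen : (List.ofFn d).length = n := List.length_ofFn
  have h' : HasPred P p (List.ofFn d).length := by rwa [hlen]
  have hk := key (List.ofFn d) hlen h'
  have hd : (fun i : Fin n => (List.ofFn d).get (i.cast hlen.symm)) = d := by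
    funext i
    simp
  rw [hd] at hk
  rw [← hk]
  exact ⟨fun ⟨_, h2⟩ => h2, fun h2 => ⟨h', h2⟩⟩

theorem represents_ans (P : Program C V) (J : TInterp P) : Represents P J (ans P J) :=
  fun _ _ h d => (mem_ans_ofFn h d).symm

/-- `Represents` does not constrain atoms of `B` over foreign predicate symbols; these are what
`ans` drops. -/
theorem Represents.ans_eq {P : Program C V} {J : TInterp P} {B : Set (GAtom C)}
    (h : Represents P J B) : ans P J = {A ∈ B | HasPred P A.pred A.args.length} := by
  ext ⟨p, l⟩
  have hl : List.ofFn (fun i : Fin l.length => l.get i) = l := List.ofFn_get l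
  constructor
  · rintro ⟨hp, hJ⟩
    have := (h _ _ hp _).1 hJ
    exact ⟨by simpa using this, hp⟩
  · rintro ⟨hB, hp⟩
    exact ⟨hp, (h _ _ hp _).2 (by simpa using hB)⟩

/-! ### Splitting of the formulas in `τ^dlv Π` -/

theorem tauAtom_splits (P : Program C V) (A : Atom C V) (h : HasAtom P A) :
    (tauAtom P A h).Splits (StdU P) := fun _ _ _ => Iff.rfl

theorem cmpForm_splits (P : Program C V) (c : Cmp) (t t' : TTerm P .gen) :
    (cmpForm P c t t').Splits (StdU P) := by
  intro H I ρ
  cases c <;> exact Iff.rfl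

theorem tauAtomic_splits (P : Program C V) (F : AtomicF C V)
    (h : ∀ A, F = AtomicF.atom A → HasAtom P A) : (tauAtomic P F h).Splits (StdU P) := by
  cases F with
  | atom A => exact tauAtom_splits P A (h A rfl)
  | cmp t c t' => exact cmpForm_splits P c _ _

theorem signed_dlv_splits (P : Program C V) (s : Sign) {F : TForm P} (h : F.Splits (StdU P)) :
    (signed P .dlv s F).Splits (StdU P) := by
  cases s with
  | pos => exact h
  | neg => exact Form.splits_sneg _
  | negneg => exact Form.splits_sneg _

/-- This is where `∼` matters: for a splitting `F`, the truth of `¬F` in `⟨H,I⟩` is decided by `I`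
alone. -/
theorem tauLit_dlv_splits (P : Program C V) (R : Rule C V) (hR : R ∈ P) (L : Lit C V)
    (hL : L ∈ R.body) : (tauLit P .dlv R hR L hL).Splits (StdU P) := by
  cases L with
  | basic l => exact signed_dlv_splits P _ (tauAtomic_splits P _ _)
  | agg s A => exact signed_dlv_splits P _ (cmpForm_splits P _ _ _)

theorem tauHead_splits (P : Program C V) (R : Rule C V) (hR : R ∈ P) :
    (tauHead P R hR).Splits (StdU P) := by
  unfold tauHead
  split
  · intro H I ρ
    simp [Form.HT, Form.Sat]
  · exact tauAtom_splits P _ _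

/-- Classically `¬` and `∼` coincide, so both semantics are handled at once. -/
theorem sat_signed {P : Program C V} {J : TInterp P} {ρ} {B : Set (GAtom C)} (x : Sem) (s : Sign)
    {F : TForm P} {G : InfForm (GAtom C)} (h : Form.Sat J ρ F ↔ InfForm.Sat B G) :
    Form.Sat J ρ (signed P x s F) ↔ InfForm.Sat B (infSigned s G) := by
  cases x <;> cases s <;>
    simp [signed, infSigned, Form.Sat, Form.neg, InfForm.Sat, InfForm.neg, InfForm.sat_bot, h]

/-! ### Universal closures and valuations of program variables -/

theorem eq_envOf (P : Program C V) (ρ : (s : TSort) → TVar V s → StdU P s) :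
    ρ = envOf P (ρ .gen) := by
  funext s
  cases s with
  | gen => rfl
  | tuple => funext e; exact e.elim
  | set => funext e; exact e.elim

/-- All assignments are quantified over anyway, so the quantifier prefix adds nothing, and an
assignment amounts to a valuation of program variables. -/
theorem forall_sat_closure {P : Program C V} {J : TInterp P} (Z : Finset V) (F : TForm P) :
    (∀ ρ, Form.Sat J ρ (closure P Z F)) ↔ ∀ θ, Form.Sat J (envOf P θ) F := by
  have : (∀ ρ, Form.Sat J ρ (closure P Z F)) ↔ ∀ ρ, Form.Sat J ρ F := by
    unfold closure
    induction Z.toList with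
    | nil => rfl
    | cons v l ih =>
      rw [← ih]
      refine ⟨fun h ρ => ?_, fun h ρ d => h _⟩
      -- Instantiating the quantifier by the current value of `v` leaves the assignment unchanged.
      exact (congrArg (fun r => Form.Sat J r _)
        (assign_self (σ := sig P) (Var := TVar V) (U := StdU P) ρ (s := TSort.gen) v)).mp
        (h ρ (ρ .gen v))
  rw [this]
  exact ⟨fun h θ => h _, fun h ρ => eq_envOf P ρ ▸ h _⟩

theorem forall_ht_closure {P : Program C V} {H I : TInterp P} (Z : Finset V) (F : TForm P) :
    (∀ ρ, Form.HT H I ρ (closure P Z F)) ↔ ∀ θ, Form.HT H I (envOf P θ) F := by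
  have : (∀ ρ, Form.HT H I ρ (closure P Z F)) ↔ ∀ ρ, Form.HT H I ρ F := by
    unfold closure
    induction Z.toList with
    | nil => rfl
    | cons v l ih =>
      rw [← ih]
      refine ⟨fun h ρ => ?_, fun h ρ d => h _⟩
      exact (congrArg (fun r => Form.HT H I r _)
        (assign_self (σ := sig P) (Var := TVar V) (U := StdU P) ρ (s := TSort.gen) v)).mp
        (h ρ (ρ .gen v))
  rw [this]
  exact ⟨fun h θ => h _, fun h ρ => eq_envOf P ρ ▸ h _⟩

theorem aggSet_congr {P : Program C V} {x : Sem} {S : SetSym C V} {hS : S ∈ setSyms P}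
    {sat sat' : ((s : TSort) → TVar V s → StdU P s) → TForm P → Prop}
    (h : ∀ θ l hl, sat (envOf P θ) (tauBasic P x l hl) ↔ sat' (envOf P θ) (tauBasic P x l hl))
    (a : {v // v ∈ S.vars} → GTerm C) : aggSet P x S hS sat a = aggSet P x S hS sat' a := by
  simp only [aggSet, h]

theorem htModels_self {P : Program C V} {I : TInterp P} {Γ : Set (TForm P)} :
    HTModels I I Γ ↔ Models I Γ := by
  simp only [HTModels, Models, Form.ht_self]

theorem Interp.Below.ans_subset {P : Program C V} {H I : TInterp P}
    (h : Interp.Below (intPred P) (intFunc P) H I) : ans P H ⊆ ans P I :=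
  fun _ ⟨hp, hA⟩ => ⟨hp, h.pred_sub _ ⟨_, _, hp, rfl⟩ _ hA⟩

variable [LinearOrder (GTerm C)]

/-! ### Classical satisfaction and infinitary satisfaction -/

theorem IsStandard.val_tauTerm {P : Program C V} {J : TInterp P} (hJ : IsStandard P J)
    (θ : V → GTerm C) (t : PTerm C V) : (tauTerm P t).val J (envOf P θ) = t.inst θ := by
  cases t with
  | ground g => exact hJ.obj g _
  | var v => rfl

theorem IsStandard.sat_cmpForm {P : Program C V} {J : TInterp P} (hJ : IsStandard P J) {ρ}
    (c : Cmp) (t t' : TTerm P .gen) :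
    Form.Sat J ρ (cmpForm P c t t') ↔
      c.Holds (C := C) (t.val J ρ) (t'.val J ρ) := by
  cases c
  · rfl
  all_goals exact hJ.cmp _ _ _

theorem sat_tauAtom {P : Program C V} {J : TInterp P} (hJ : IsStandard P J)
    {B : Set (GAtom C)} (hB : Represents P J B) (θ : V → GTerm C) (A : Atom C V)
    (h : HasAtom P A) : Form.Sat J (envOf P θ) (tauAtom P A h) ↔ A.inst θ ∈ B := by
  have h1 := hB A.pred A.args.length ⟨A, h, rfl, rfl⟩ (fun i => (A.args.get i).inst θ)
  have h2 : List.ofFn (fun i => (A.args.get i).inst θ) = A.args.map (PTerm.inst θ) := by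
    conv_rhs => rw [← List.ofFn_get A.args, List.map_ofFn]
    rfl
  rw [h2] at h1
  refine Iff.trans ?_ h1
  have h3 : (fun i => (tauTerm P (A.args.get i)).val J (envOf P θ)) =
      fun i => (A.args.get i).inst θ := funext fun i => hJ.val_tauTerm θ _
  exact iff_of_eq (congrArg (J.pred (PredSym.pred A.pred A.args.length ⟨A, h, rfl, rfl⟩)) h3)

theorem sat_tauAtomic {P : Program C V} {J : TInterp P} (hJ : IsStandard P J)
    {B : Set (GAtom C)} (hB : Represents P J B) (θ : V → GTerm C) (F : AtomicF C V)
    (h : ∀ A, F = AtomicF.atom A → HasAtom P A) :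
    Form.Sat J (envOf P θ) (tauAtomic P F h) ↔ InfForm.Sat B (infAtomic θ F) := by
  cases F with
  | atom A => exact sat_tauAtom hJ hB θ A (h A rfl)
  | cmp t c t' =>
    refine (hJ.sat_cmpForm c _ _).trans ?_
    rw [hJ.val_tauTerm, hJ.val_tauTerm, infAtomic]
    split_ifs with hc <;> simp [hc, InfForm.sat_top, InfForm.sat_bot]

theorem sat_tauBasic {P : Program C V} {J : TInterp P} (hJ : IsStandard P J)
    {B : Set (GAtom C)} (hB : Represents P J B) (x : Sem) (θ : V → GTerm C) (l : BasicLit C V)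
    (h : HasLit P l) :
    Form.Sat J (envOf P θ) (tauBasic P x l h) ↔ InfForm.Sat B (infBasic θ l) :=
  sat_signed x l.sign (sat_tauAtomic hJ hB θ l.form _)

/-- Satisfaction of a basic literal depends only on the ground atoms satisfied. -/
theorem ht_tauBasic_congr {P : Program C V} {H H' I : TInterp P} (hH : IsStandard P H)
    (hH' : IsStandard P H') {B : Set (GAtom C)} (hB : Represents P H B)
    (hB' : Represents P H' B) (x : Sem) (θ : V → GTerm C) (l : BasicLit C V) (h : HasLit P l) :
    Form.HT H I (envOf P θ) (tauBasic P x l h) ↔ Form.HT H' I (envOf P θ) (tauBasic P x l h) := by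
  have hs : ∀ F : TForm P, F = tauAtomic P l.form (fun _ hA => Or.inr ⟨l, h, hA⟩) →
      (Form.Sat H (envOf P θ) F ↔ Form.Sat H' (envOf P θ) F) ∧
        (Form.HT H I (envOf P θ) F ↔ Form.HT H' I (envOf P θ) F) := by
    rintro F rfl
    have := (sat_tauAtomic hH hB θ l.form (fun _ hA => Or.inr ⟨l, h, hA⟩)).trans
      (sat_tauAtomic hH' hB' θ l.form (fun _ hA => Or.inr ⟨l, h, hA⟩)).symm
    exact ⟨this, (tauAtomic_splits P _ _ H I _).trans
      ((and_congr_right' this).trans (tauAtomic_splits P _ _ H' I _).symm)⟩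
  unfold tauBasic
  obtain ⟨h1, h2⟩ := hs _ rfl
  -- The clause for `∼` needs the classical equivalence `h1`, that for `¬` the ht equivalence `h2`.
  cases x <;> cases l.sign <;> simp [signed, Form.neg, Form.HT, Form.Sat, h1, h2]

/-- A standard interpretation in which the functions `s^dlv` have their intended meaning. -/
structure IsDlvStandard (P : Program C V) (J : TInterp P) : Prop where
  std : IsStandard P J
  dlv : ∀ (S : SetSym C V) (hS : S ∈ setSyms P) (a : {v // v ∈ S.vars} → GTerm C),
    J.func (FuncSym.setfn .dlv S hS) a = aggSet P .dlv S hS (Form.Sat J) a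

/-- `I` and `H` meet the same condition, so the classical correspondence is proved once and used for
both worlds. -/
theorem IsAgg.isDlvStandard {P : Program C V} {I : TInterp P} (h : IsAgg P I) :
    IsDlvStandard P I := ⟨h.std, h.set .dlv⟩

theorem IsAggHT.isDlvStandard {P : Program C V} {H I : TInterp P} (h : IsAggHT P H I) :
    IsDlvStandard P H := ⟨h.stdH, h.dlv⟩

/-- By `sat_infAgg` both sides compare the guard with the same operation applied to a set of tuples;
`himage` shows that these sets coincide. -/
theorem sat_tauAggAtom {P : Program C V} {J : TInterp P} (hJ : IsDlvStandard P J)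
    {B : Set (GAtom C)} (hB : Represents P J B) {θ θ' : V → GTerm C} {R : Rule C V}
    (hθ : ∀ v ∈ R.globals, θ v = θ' v) (A : AggAtom C V)
    (hS : R.setSym A.elem ∈ setSyms P) (hg : ∀ v ∈ A.guard.vars, v ∈ R.globals) :
    Form.Sat J (envOf P θ) (tauAggAtom P .dlv (R.setSym A.elem) hS A.op A.cmp A.guard) ↔
      InfForm.Sat B (infAgg θ' (R.setSym A.elem).locals A) := by
  have himage : Subtype.val '' aggSet P .dlv (R.setSym A.elem) hS (Form.Sat J)
        (fun v => θ v.1) =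
      (fun y => A.elem.terms.map (PTerm.inst (override (R.setSym A.elem).locals y θ'))) ''
        {y | InfForm.Sat B (infLits (override (R.setSym A.elem).locals y θ') A.elem)} := by
    have hagree := fun y : {v // v ∈ (R.setSym A.elem).locals} → GTerm C =>
      override_agree (E := A.elem) hθ y
    have hterms := fun y => map_inst_congr (ts := A.elem.terms)
      fun v hv => hagree y v (AggElem.mem_vars.2 (Or.inl hv))
    have hlits : ∀ y, (∀ l, ∀ hl : l ∈ A.elem.lits,
        Form.Sat J (envOf P (override (R.setSym A.elem).locals y
          (valOf (R.setSym A.elem).vars fun v => θ v.1)))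
          (tauBasic P .dlv l (hasLit_of_setSym hS hl))) ↔
        InfForm.Sat B (infLits (override (R.setSym A.elem).locals y θ') A.elem) := by
      intro y
      rw [infLits, InfForm.sat_conjList, List.forall_mem_map]
      refine forall₂_congr fun l hl => ?_
      rw [sat_tauBasic hJ.std hB]
      exact iff_of_eq (congrArg _ (infBasic_congr
        fun v hv => hagree y v (AggElem.mem_vars.2 (Or.inr ⟨l, hl, hv⟩))))
    ext t
    constructor
    · rintro ⟨t, ⟨y, ht, hl⟩, rfl⟩
      exact ⟨y, (hlits y).1 hl, (ht.trans (hterms y)).symm⟩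
    · rintro ⟨y, hl, rfl⟩
      exact ⟨⟨_, by simpa using ⟨_, hS, rfl⟩⟩, ⟨y, (hterms y).symm, (hlits y).2 hl⟩, rfl⟩
  refine (hJ.std.sat_cmpForm _ _ _).trans ?_
  rw [hJ.std.val_tauTerm, sat_infAgg, Justifies, ← himage, ← hJ.dlv,
    PTerm.inst_congr fun v hv => hθ v (hg v hv)]
  exact iff_of_eq (congrArg (fun g => A.cmp.Holds g _) (hJ.std.op A.op _))

theorem sat_tauLit {P : Program C V} {J : TInterp P} (hJ : IsDlvStandard P J)
    {B : Set (GAtom C)} (hB : Represents P J B) {θ θ' : V → GTerm C} {R : Rule C V} (hR : R ∈ P)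
    (hθ : ∀ v ∈ R.globals, θ v = θ' v) (L : Lit C V) (hL : L ∈ R.body) :
    Form.Sat J (envOf P θ) (tauLit P .dlv R hR L hL) ↔ InfForm.Sat B (infLit R θ' L) := by
  cases L with
  | basic l =>
    refine (sat_tauBasic hJ.std hB .dlv θ l ⟨R, hR, Or.inl hL⟩).trans ?_
    rw [infLit, infBasic_congr fun v hv => hθ v (Rule.mem_globals_of_body hL hv)]
  | agg s A =>
    exact sat_signed .dlv s (sat_tauAggAtom hJ hB hθ A _
      fun v hv => Rule.mem_globals_of_body hL hv)

theorem sat_body {P : Program C V} {J : TInterp P} (hJ : IsDlvStandard P J)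
    {B : Set (GAtom C)} (hB : Represents P J B) {θ θ' : V → GTerm C} {R : Rule C V} (hR : R ∈ P)
    (hθ : ∀ v ∈ R.globals, θ v = θ' v) :
    Form.Sat J (envOf P θ)
        (Form.conjList (R.body.attach.map (fun L => tauLit P .dlv R hR L.1 L.2))) ↔
      InfForm.Sat B (InfForm.conjList (R.body.map (infLit R θ'))) := by
  rw [Form.sat_conjList, InfForm.sat_conjList, List.forall_mem_map, List.forall_mem_map]
  constructor
  · exact fun h L hL => (sat_tauLit hJ hB hR hθ L hL).1 (h ⟨L, hL⟩ (List.mem_attach _ _))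
  · exact fun h L _ => (sat_tauLit hJ hB hR hθ L.1 L.2).2 (h L.1 L.2)

theorem sat_tauHead {P : Program C V} {J : TInterp P} (hJ : IsStandard P J)
    {B : Set (GAtom C)} (hB : Represents P J B) {θ θ' : V → GTerm C} {R : Rule C V} (hR : R ∈ P)
    (hθ : ∀ v ∈ R.globals, θ v = θ' v) :
    Form.Sat J (envOf P θ) (tauHead P R hR) ↔ InfForm.Sat B (infHead θ' R.head) := by
  rw [← infHead_congr hθ]
  unfold tauHead
  split
  · next h => simp [h, infHead, Form.Sat, InfForm.sat_bot]
  · next A h =>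
    refine (sat_tauAtom hJ hB θ A (Or.inl ⟨R, hR, h⟩)).trans ?_
    rw [h]
    rfl

/-- The models of `τ^dlv Π` correspond to the models of `τΠ`. -/
theorem models_tauProgram_iff {P : Program C V} {J : TInterp P} (hJ : IsDlvStandard P J)
    {B : Set (GAtom C)} (hB : Represents P J B) :
    Models J (tauProgram P .dlv) ↔ InfForm.Sat B (infProgram P) := by
  have hrule : ∀ R (hR : R ∈ P), (∀ ρ, Form.Sat J ρ (tauRule P .dlv R hR)) ↔
      InfForm.Sat B (infRule R) := by
    intro R hR
    rw [tauRule, forall_sat_closure]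
    simp only [infRule, InfForm.Sat, Form.Sat]
    constructor
    · intro h z
      rw [← sat_body hJ hB hR fun _ _ => rfl, ← sat_tauHead hJ.std hB hR fun _ _ => rfl]
      exact h _
    · intro h θ
      rw [sat_body hJ hB hR (valOf_agree _ θ), sat_tauHead hJ.std hB hR (valOf_agree _ θ)]
      exact h _
  constructor
  · rintro h ⟨R, hR⟩
    exact (hrule R hR).1 (h _ ⟨R, hR, rfl⟩)
  · rintro h F ⟨R, hR, rfl⟩
    exact (hrule R hR).2 (h ⟨R, hR⟩)

/-- Satisfaction of `τ^dlv Π` in the here-and-there sense corresponds to satisfaction of the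
FLP-reduct of `τΠ`. -/
theorem htModels_tauProgram_iff {P : Program C V} {H I : TInterp P} (hH : IsDlvStandard P H)
    (hI : IsDlvStandard P I) {A B : Set (GAtom C)} (hB : Represents P H B)
    (hA : Represents P I A) (hmod : Models I (tauProgram P .dlv)) :
    HTModels H I (tauProgram P .dlv) ↔
      InfForm.Sat B (InfForm.flp A (infProgram P)) := by
  have hrule : ∀ R (hR : R ∈ P), (∀ ρ, Form.HT H I ρ (tauRule P .dlv R hR)) ↔
      InfForm.Sat B (InfForm.flp A (infRule R)) := by
    intro R hR
    have hI' := hmod _ ⟨R, hR, rfl⟩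
    rw [tauRule, forall_sat_closure] at hI'
    have hb : (Form.conjList
        (R.body.attach.map (fun L => tauLit P .dlv R hR L.1 L.2))).Splits (StdU P) := by
      apply Form.splits_conjList
      rw [List.forall_mem_map]
      exact fun L _ => tauLit_dlv_splits P R hR L.1 L.2
    have hstep : ∀ θ θ' : V → GTerm C, (∀ v ∈ R.globals, θ v = θ' v) →
        (Form.HT H I (envOf P θ) (Form.imp (Form.conjList
          (R.body.attach.map (fun L => tauLit P .dlv R hR L.1 L.2))) (tauHead P R hR)) ↔
        (InfForm.Sat A (InfForm.conjList (R.body.map (infLit R θ'))) →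
          InfForm.Sat B (InfForm.conjList (R.body.map (infLit R θ'))) →
          InfForm.Sat B (infHead θ' R.head))) := by
      intro θ θ' hθ
      -- As `I` already satisfies the rule, its share of the ht implication is automatic, and only
      -- the head in `H` remains to be forced.
      have h0 := hI' θ
      simp only [Form.HT]
      rw [hb, tauHead_splits]
      simp only [Form.Sat] at h0 ⊢
      rw [sat_body hI hA hR hθ, sat_tauHead hI.std hA hR hθ] at h0 ⊢
      rw [sat_body hH hB hR hθ, sat_tauHead hH.std hB hR hθ]
      tauto
    rw [tauRule, forall_ht_closure]
    constructor
    · intro h z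
      exact InfForm.sat_flp_imp.2 ((hstep _ _ fun _ _ => rfl).1 (h _))
    · intro h θ
      exact (hstep _ _ (valOf_agree _ θ)).2 (InfForm.sat_flp_imp.1 (h _))
  constructor
  · rintro h ⟨R, hR⟩
    exact (hrule R hR).1 (h _ ⟨R, hR, rfl⟩)
  · rintro h F ⟨R, hR, rfl⟩
    exact (hrule R hR).2 (h ⟨R, hR⟩)

/-! ## Construction of standard interpretations -/

/-- The standard interpretation with the ground atoms `B` and the set functions `g`. -/
noncomputable def stdInterp (P : Program C V) (B : Set (GAtom C))
    (g : Sem → (S : SetSym C V) → S ∈ setSyms P → ({v // v ∈ S.vars} → GTerm C) →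
      Set (Tuple P)) : TInterp P where
  func
    | .obj c => fun _ => c
    | .tuple k h => fun d : Fin k → GTerm C =>
        (⟨List.ofFn d, by simpa using h⟩ : Tuple P)
    | .op o => fun d : Fin 1 → Set (Tuple P) => o.hat (Subtype.val '' d 0)
    | .setfn x S h => g x S h
  pred
    | .pred p n _ => fun d : Fin n → GTerm C => (⟨p, List.ofFn d⟩ : GAtom C) ∈ B
    | .cmp c _ => fun d : Fin 2 → GTerm C => c.Holds (d 0) (d 1)
    | .mem => fun d => Membership.mem (α := Tuple P) (γ := Set (Tuple P))
        (d (1 : Fin 2)) (d (0 : Fin 2))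

theorem isStandard_stdInterp (P : Program C V) (B g) : IsStandard P (stdInterp P B g) where
  obj _ _ := rfl
  cmp _ _ _ := Iff.rfl
  tuple _ _ _ := rfl
  mem _ := Iff.rfl
  op _ _ := rfl

theorem represents_stdInterp (P : Program C V) (B g) : Represents P (stdInterp P B g) B :=
  fun _ _ _ _ => Iff.rfl

/-- Standardness fixes all non-intensional symbols, so only inclusion of ground atoms is left of
`⪯`. -/
theorem IsStandard.below {P : Program C V} {H I : TInterp P} (hH : IsStandard P H)
    (hI : IsStandard P I) (h : ans P H ⊆ ans P I) :
    Interp.Below (intPred P) (intFunc P) H I where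
  pred_sub := by
    rintro _ ⟨p, n, hp, rfl⟩ d hd
    exact (mem_ans_ofFn hp d).1 (h ((mem_ans_ofFn hp d).2 hd))
  pred_eq := by
    intro p hp
    funext d
    cases p with
    | pred p n h => exact absurd ⟨p, n, h, rfl⟩ hp
    | cmp c hc => exact propext ((hH.cmp c hc d).trans (hI.cmp c hc d).symm)
    | mem => exact propext ((hH.mem d).trans (hI.mem d).symm)
  func_eq := by
    intro f hf
    funext d
    cases f with
    | obj g => exact (hH.obj g d).trans (hI.obj g d).symm
    | tuple k hk => exact (hH.tuple k hk d).trans (hI.tuple k hk d).symm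
    | op o =>
      have hd : d = fun _ : Fin 1 => d (0 : Fin 1) :=
        funext fun i : Fin 1 => congrArg d (Subsingleton.elim i (0 : Fin 1))
      rw [hd]
      exact (hH.op o _).trans (hI.op o _).symm
    | setfn x S h => exact absurd ⟨x, S, h, rfl⟩ hf

/-! ### Worlds determined by their ground atoms -/

/-- In an agg-ht-interpretation, the two worlds are equal if they satisfy the same ground
atoms. -/
theorem IsAggHT.eq_of_ans_eq {P : Program C V} {H I : TInterp P} (h : IsAggHT P H I)
    (hans : ans P H = ans P I) : H = I := by
  have hHrep : Represents P H (ans P I) := hans ▸ represents_ans P H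
  have hIrep := represents_ans P I
  apply Interp.ext
  · funext f
    by_cases hf : f ∈ intFunc P
    · obtain ⟨x, S, hS, rfl⟩ := hf
      funext a
      rw [h.agg.set x S hS a]
      cases x with
      | cli =>
        refine (h.cli S hS a).trans (aggSet_congr (fun θ l hl => ?_) a)
        -- With equal atoms `H` may be replaced by `I`, and satisfaction by `⟨I,I⟩` is classical.
        rw [ht_tauBasic_congr h.stdH h.agg.std hHrep hIrep, Form.ht_self]
      | dlv =>
        refine (h.dlv S hS a).trans (aggSet_congr (fun θ l hl => ?_) a)
        rw [sat_tauBasic h.stdH hHrep, sat_tauBasic h.agg.std hIrep]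
    · exact h.below.func_eq f hf
  · funext p
    by_cases hp : p ∈ intPred P
    · obtain ⟨p, n, hp, rfl⟩ := hp
      funext d
      exact propext ((hHrep p n hp d).trans (hIrep p n hp d).symm)
    · exact h.below.pred_eq p hp

/-- The definition of the set functions is not circular: basic literals do not mention them, so
their conditions can be evaluated with all set functions constantly empty. -/
theorem exists_isAgg (P : Program C V) (A : Set (GAtom C)) :
    ∃ I : TInterp P, IsAgg P I ∧ Represents P I A := by
  refine ⟨stdInterp P A fun x S hS =>
    aggSet P x S hS (Form.Sat (stdInterp P A fun _ _ _ _ => ∅)), ⟨isStandard_stdInterp _ _ _, ?_⟩,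
    represents_stdInterp _ _ _⟩
  intro x S hS a
  refine aggSet_congr (fun θ l hl => ?_) a
  rw [sat_tauBasic (isStandard_stdInterp _ _ _) (represents_stdInterp _ _ _),
    sat_tauBasic (isStandard_stdInterp _ _ _) (represents_stdInterp _ _ _)]

/-- Every candidate for a smaller model of the reduct is realised by a world. Inclusion in `ans P I`
gives `H ⪯ I` and rules out foreign atoms in `B`. -/
theorem exists_isAggHT {P : Program C V} {I : TInterp P} (hI : IsAgg P I) {B : Set (GAtom C)}
    (hB : B ⊆ ans P I) : ∃ H : TInterp P, IsAggHT P H I ∧ ans P H = B := by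
  let H₀ : TInterp P := stdInterp P B fun _ _ _ _ => ∅
  let H : TInterp P := stdInterp P B fun x S hS =>
    match x with
    | .cli => aggSet P .cli S hS (Form.HT H₀ I)
    | .dlv => aggSet P .dlv S hS (Form.Sat H₀)
  have hstd : IsStandard P H := isStandard_stdInterp _ _ _
  have hstd₀ : IsStandard P H₀ := isStandard_stdInterp _ _ _
  have hrep : Represents P H B := represents_stdInterp _ _ _
  have hrep₀ : Represents P H₀ B := represents_stdInterp _ _ _
  have hans : ans P H = B := by
    rw [hrep.ans_eq]
    exact Set.sep_eq_self_iff_mem_true.2 fun A hA => (hB hA).1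
  refine ⟨H, ⟨hstd.below hI.std (hans ▸ hB), hstd, hI, fun S hS a => ?_, fun S hS a => ?_⟩, hans⟩
  · exact aggSet_congr (fun θ l hl => ht_tauBasic_congr hstd₀ hstd hrep₀ hrep _ θ l hl) a
  · refine aggSet_congr (fun θ l hl => ?_) a
    rw [sat_tauBasic hstd hrep, sat_tauBasic hstd₀ hrep₀]

/-! ### Stable models and answer sets -/

/-- A model of the FLP-reduct of `τΠ` with respect to `A` that is minimal corresponds to an
agg-stable model. -/
theorem isAggStable_iff {P : Program C V} {I : TInterp P} (hI : IsAgg P I) :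
    IsAggStable P (tauProgram P .dlv) I ↔ IsDlvAnswerSet P (ans P I) := by
  have hrep := represents_ans P I
  -- A set satisfies its own FLP-reduct iff it satisfies the original formula.
  have hflp : InfForm.Sat (ans P I) (InfForm.flp (ans P I) (infProgram P)) ↔
      Models I (tauProgram P .dlv) := by
    rw [models_tauProgram_iff hI.isDlvStandard hrep]
    simp only [infProgram, infRule, InfForm.flp, InfForm.Sat]
    refine forall₂_congr fun R z => InfForm.sat_flp_imp.trans ?_
    tauto
  constructor
  · rintro ⟨-, hm, hs⟩
    refine ⟨hflp.2 hm, fun ⟨B, hBA, hB⟩ => hs ?_⟩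
    obtain ⟨H, hH, rfl⟩ := exists_isAggHT hI hBA.subset
    exact ⟨H, hH, (htModels_tauProgram_iff hH.isDlvStandard hI.isDlvStandard
      (represents_ans P H) hrep hm).2 hB, hH.below, fun h => hBA.ne (by rw [h])⟩
  · rintro ⟨hm, hs⟩
    rw [hflp] at hm
    refine ⟨hI, hm, fun ⟨H, hH, hmod, hlt⟩ => hs ⟨ans P H, ?_, ?_⟩⟩
    -- The worlds cannot differ in their set functions alone, so `H ≺ I` gives a proper inclusion of
    -- atoms.
    · exact hH.below.ans_subset.ssubset_of_ne fun h => hlt.2 (hH.eq_of_ans_eq h)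
    · exact (htModels_tauProgram_iff hH.isDlvStandard hI.isDlvStandard
        (represents_ans P H) hrep hm).1 hmod

/-- The atoms of a dlv answer set are formed from the predicate symbols of the program. -/
theorem IsDlvAnswerSet.eq_ans {P : Program C V} {A : Set (GAtom C)} (h : IsDlvAnswerSet P A)
    {I : TInterp P} (hI : IsAgg P I) (hA : Represents P I A) : A = ans P I := by
  obtain ⟨hm, hs⟩ := h
  have hd := hI.isDlvStandard
  have hmod : Models I (tauProgram P .dlv) := by
    rw [models_tauProgram_iff hd hA]
    simp only [infProgram, infRule, InfForm.flp, InfForm.Sat] at hm ⊢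
    exact fun R z hz => InfForm.sat_flp_imp.1 (hm R z) hz hz
  have hsub : ans P I ⊆ A := by
    rw [hA.ans_eq]
    exact Set.sep_subset _ _
  by_contra hne
  -- Both `ans P I` and `A` represent `I`. Reading `⟨I,I⟩` with `ans P I` for the first world and
  -- `A` for the second shows that `ans P I` satisfies the reduct with respect to `A`, against
  -- minimality.
  exact hs ⟨ans P I, hsub.ssubset_of_ne (Ne.symm hne),
    (htModels_tauProgram_iff hd hd (represents_ans P I) hA hmod).1 (htModels_self.2 hmod)⟩

end Target

end AggLP

theorem mainTheorem2 {C V : Type} [DecidableEq V] [LinearOrder (AggLP.GTerm C)]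
    (_hord : AggLP.AdmissibleOrder C) (P : AggLP.Program C V) :
    {A : Set (AggLP.GAtom C) | AggLP.IsFoDlvAnswerSet P A} =
      {A : Set (AggLP.GAtom C) | AggLP.IsDlvAnswerSet P A} := by
  ext A
  constructor
  · rintro ⟨I, hI, rfl⟩
    exact (AggLP.isAggStable_iff hI.agg).1 hI
  · intro hA
    obtain ⟨I, hI, hrep⟩ := AggLP.exists_isAgg P A
    have hA' : A = AggLP.ans P I := AggLP.IsDlvAnswerSet.eq_ans hA hI hrep
    exact ⟨I, (AggLP.isAggStable_iff hI).2 (hA' ▸ hA), hA'⟩
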